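/- Let $\mathfrak g_0$ be a finite-dimensional non-compact real semisimple Lie algebra (semisimple, with Killing form $B$ not negative definite), let $\sigma$ be an involutive automorphism of $\mathfrak g_0$, and let $\theta$ be a Cartan involution of $\mathfrak g_0$ (an involutive automorphism such that $-B(X,\theta X)>0$ for all $X\neq 0$) with $\sigma\theta=\theta\sigma$. For a $\theta$-stable real subspace $V$ write $V^{\pm\theta}=\{X\in V:\theta X=\pm X\}$. Extend $\sigma,\theta$ $\mathbb C$-linearly to $\mathfrak g_{\mathbb C}=\mathfrak g_0\otimes_{\mathbb R}\mathbb C$, and put $$\mathfrak g=\mathfrak g_0^{\theta}+\sqrt{-1}\,\mathfrak g_0^{-\theta}\subset\mathfrak g_{\mathbb C},\qquad \theta_1=\theta|_{\mathfrak g},\qquad \theta_2=\sigma|_{\mathfrak g}.$$ Then $(\mathfrak g,\theta_1,\theta_2)$ is a commutative compact semisimple symmetric triad, i.e. $\mathfrak g$ is a real semisimple Lie algebra with negative definite Killing form and $\theta_1,\theta_2$ are commuting involutive automorphisms of $\mathfrak g$; it is called the dual triad of $(\mathfrak g_0,\sigma;\theta)$. Moreover: (1) The map $\mathfrak l_0\mapsto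 \mathfrak l_0^*:=\mathfrak l_0^{\theta}+\sqrt{-1}\,\mathfrak l_0^{-\theta}$ is a bijection from the set of $\sigma$- and $\theta$-invariant ideals of $\mathfrak g_0$ onto the set of $\theta_1$- and $\theta_2$-invariant ideals of $\mathfrak g$, and its inverse is $\mathfrak l\mapsto \mathfrak l^*:=\mathfrak l^{\theta_1}+\sqrt{-1}\,\mathfrak l^{-\theta_1}$. (2) $(\mathfrak g_0,\sigma)$ is irreducible, i.e. $0$ and $\mathfrak g_0$ are the only $\sigma$-invariant ideals of $\mathfrak g_0$, if and only if $(\mathfrak g,\theta_1,\theta_2)$ is irreducible, i.e. $0$ and $\mathfrak g$ are the only ideals of $\mathfrak g$ that are invariant under both $\theta_1$ and $\theta_2$. -/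

import Mathlib

open scoped TensorProduct Pointwise

noncomputable section

namespace SymmDuality

/-! ### Involutions, compactness, irreducibility for real Lie algebras -/

section General

variable {L : Type*} [LieRing L] [LieAlgebra ℝ L]

/-- A Lie algebra endomorphism with square the identity, i.e. an involutive automorphism
(the identity is allowed). -/
def IsInvolution (f : L →ₗ⁅ℝ⁆ L) : Prop := ∀ x, f (f x) = x

/-- Two endomorphisms commute. -/
def Commuting (f h : L →ₗ⁅ℝ⁆ L) : Prop := ∀ x, f (h x) = h (f x)

variable (L) in
/-- A real (finite-dimensional) semisimple Lie algebra is compact if its Killing form is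
negative definite. -/
structure IsCompactSemisimple : Prop where
  semisimple : LieAlgebra.IsSemisimple ℝ L
  killing_neg : ∀ x : L, x ≠ 0 → killingForm ℝ L x x < 0

variable (L) in
/-- A real (finite-dimensional) semisimple Lie algebra which is not compact. -/
structure IsNoncompactSemisimple : Prop where
  semisimple : LieAlgebra.IsSemisimple ℝ L
  not_compact : ¬ IsCompactSemisimple L

/-- `θ` is a Cartan involution: an involution for which the form `(x, y) ↦ -B(x, θ y)`, with `B`
the Killing form, is positive definite. -/
structure IsCartanInvolution (θ : L →ₗ⁅ℝ⁆ L) : Prop where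
  involution : IsInvolution θ
  pos : ∀ x : L, x ≠ 0 → 0 < -(killingForm ℝ L x (θ x))

/-- `(L, σ)` is a non-compact semisimple symmetric pair. -/
structure IsNoncompactPair (σ : L →ₗ⁅ℝ⁆ L) : Prop where
  noncompact : IsNoncompactSemisimple L
  involution : IsInvolution σ

/-- `(L, σ; θ)` is a non-compact semisimple symmetric pair equipped with a Cartan involution. -/
structure IsNoncompactPairWithCartan (σ θ : L →ₗ⁅ℝ⁆ L) : Prop where
  pair : IsNoncompactPair σ
  cartan : IsCartanInvolution θ
  comm : Commuting σ θ

/-- `(L, θ₁, θ₂)` is a commutative compact semisimple symmetric triad. -/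
structure IsCommCompactTriad (θ₁ θ₂ : L →ₗ⁅ℝ⁆ L) : Prop where
  compact : IsCompactSemisimple L
  involution₁ : IsInvolution θ₁
  involution₂ : IsInvolution θ₂
  comm : Commuting θ₁ θ₂

/-- The ideal `I` is invariant under `f`. -/
def IsInvariant (f : L →ₗ⁅ℝ⁆ L) (I : LieIdeal ℝ L) : Prop := ∀ x ∈ I, f x ∈ I

/-- The set of all ideals which are invariant under both `f` and `h`. -/
def invariantIdeals (f h : L →ₗ⁅ℝ⁆ L) : Set (LieIdeal ℝ L) :=
  {I | IsInvariant f I ∧ IsInvariant h I}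

/-- `(L, σ)` has no `σ`-invariant ideals besides `0` and `L`. -/
def IsIrreduciblePair (σ : L →ₗ⁅ℝ⁆ L) : Prop :=
  ∀ I : LieIdeal ℝ L, IsInvariant σ I → I = ⊥ ∨ I = ⊤

/-- `(L, θ₁, θ₂)` has no `θ₁`- and `θ₂`-invariant ideals besides `0` and `L`. -/
def IsIrreducibleTriad (θ₁ θ₂ : L →ₗ⁅ℝ⁆ L) : Prop :=
  ∀ I : LieIdeal ℝ L, IsInvariant θ₁ I → IsInvariant θ₂ I → I = ⊥ ∨ I = ⊤

end General

/-! ### The dual triad, inside the complexification -/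

section Dual

variable {g₀ : Type*} [LieRing g₀] [LieAlgebra ℝ g₀]

/-- The `ℂ`-linear extension `id ⊗ f` of `f` to the complexification of `g₀`, regarded as a
homomorphism of real Lie algebras. -/
def complexify (f : g₀ →ₗ⁅ℝ⁆ g₀) : (ℂ ⊗[ℝ] g₀) →ₗ⁅ℝ⁆ (ℂ ⊗[ℝ] g₀) :=
  LieAlgebra.ExtendScalars.map (AlgHom.id ℝ ℂ) f

/-- A real subspace `W` of `g₀`, regarded as the real subspace `1 ⊗ W` of the complexification. -/
def toComplexification (W : Submodule ℝ g₀) : Submodule ℝ (ℂ ⊗[ℝ] g₀) :=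
  W.map (TensorProduct.mk ℝ ℂ g₀ 1)

/-- For a real subspace `W` of the complexification of `g₀`, the real subspace
`W^θ + √-1 W^{-θ}`, where `θ` is extended `ℂ`-linearly. -/
def dualSubspace (θ : g₀ →ₗ⁅ℝ⁆ g₀) (W : Submodule ℝ (ℂ ⊗[ℝ] g₀)) :
    Submodule ℝ (ℂ ⊗[ℝ] g₀) :=
  (W ⊓ LinearMap.ker ((complexify θ : (ℂ ⊗[ℝ] g₀) →ₗ[ℝ] (ℂ ⊗[ℝ] g₀)) - LinearMap.id)) ⊔
    Complex.I •
      (W ⊓ LinearMap.ker ((complexify θ : (ℂ ⊗[ℝ] g₀) →ₗ[ℝ] (ℂ ⊗[ℝ] g₀)) + LinearMap.id))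

lemma mem_dualSubspace {θ : g₀ →ₗ⁅ℝ⁆ g₀} {W : Submodule ℝ (ℂ ⊗[ℝ] g₀)} {z : ℂ ⊗[ℝ] g₀} :
    z ∈ dualSubspace θ W ↔ ∃ a ∈ W, ∃ b ∈ W, complexify θ a = a ∧ complexify θ b = -b ∧
      z = a + Complex.I • b := by
  simp only [dualSubspace, Submodule.mem_sup, Submodule.mem_smul_pointwise_iff_exists,
    Submodule.mem_inf, LinearMap.mem_ker, LinearMap.sub_apply, LinearMap.add_apply,
    LinearMap.id_apply, sub_eq_zero, add_eq_zero_iff_eq_neg, LieHom.coe_toLinearMap]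
  constructor
  · rintro ⟨a, ⟨ha, ha'⟩, _, ⟨b, ⟨hb, hb'⟩, rfl⟩, rfl⟩
    exact ⟨a, ha, b, hb, ha', hb', rfl⟩
  · rintro ⟨a, ha, b, hb, ha', hb', rfl⟩
    exact ⟨a, ⟨ha, ha'⟩, _, ⟨b, ⟨hb, hb'⟩, rfl⟩, rfl⟩

lemma lie_mem_toComplexification {U V W : Submodule ℝ g₀}
    (h : ∀ x ∈ U, ∀ y ∈ V, ⁅x, y⁆ ∈ W) {a b : ℂ ⊗[ℝ] g₀}
    (ha : a ∈ toComplexification U) (hb : b ∈ toComplexification V) :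
    ⁅a, b⁆ ∈ toComplexification W := by
  obtain ⟨x, hx, rfl⟩ := ha
  obtain ⟨y, hy, rfl⟩ := hb
  exact ⟨⁅x, y⁆, h x hx y hy, by simp⟩

lemma lie_mem_dualSubspace (θ : g₀ →ₗ⁅ℝ⁆ g₀) {U V W : Submodule ℝ g₀}
    (h : ∀ x ∈ U, ∀ y ∈ V, ⁅x, y⁆ ∈ W) {a b : ℂ ⊗[ℝ] g₀}
    (ha : a ∈ dualSubspace θ (toComplexification U))
    (hb : b ∈ dualSubspace θ (toComplexification V)) :
    ⁅a, b⁆ ∈ dualSubspace θ (toComplexification W) := by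
  obtain ⟨k, hk, p, hp, hk', hp', rfl⟩ := mem_dualSubspace.1 ha
  obtain ⟨l, hl, q, hq, hl', hq', rfl⟩ := mem_dualSubspace.1 hb
  refine mem_dualSubspace.2 ⟨⁅k, l⁆ - ⁅p, q⁆,
    sub_mem (lie_mem_toComplexification h hk hl) (lie_mem_toComplexification h hp hq),
    ⁅k, q⁆ + ⁅p, l⁆,
    add_mem (lie_mem_toComplexification h hk hq) (lie_mem_toComplexification h hp hl), ?_, ?_, ?_⟩
  · simp [hk', hl', hp', hq']
  · simp [hk', hl', hp', hq']; abel
  · have hl : ∀ x y : ℂ ⊗[ℝ] g₀, ⁅Complex.I • x, y⁆ = Complex.I • ⁅x, y⁆ :=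
      fun x y => LieModule.smul_lie (R := ℂ) Complex.I x y
    have hr : ∀ x y : ℂ ⊗[ℝ] g₀, ⁅x, Complex.I • y⁆ = Complex.I • ⁅x, y⁆ :=
      fun x y => LieModule.lie_smul (R := ℂ) Complex.I x y
    have h1 : ⁅Complex.I • p, Complex.I • q⁆ = -⁅p, q⁆ := by
      rw [hl, hr, smul_smul, Complex.I_mul_I, neg_one_smul]
    rw [add_lie, lie_add, lie_add, h1, hl, hr, smul_add]
    abel

/-- The Lie algebra `g = g₀^θ + √-1 g₀^{-θ}`, a real Lie subalgebra of the complexification. -/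
def dualAlgebra (θ : g₀ →ₗ⁅ℝ⁆ g₀) : LieSubalgebra ℝ (ℂ ⊗[ℝ] g₀) where
  toSubmodule := dualSubspace θ (toComplexification ⊤)
  lie_mem' ha hb := lie_mem_dualSubspace θ (fun _ _ _ _ => Submodule.mem_top) ha hb

lemma complexify_mem_dualAlgebra {f θ : g₀ →ₗ⁅ℝ⁆ g₀} (hf : Commuting f θ) {z : ℂ ⊗[ℝ] g₀}
    (hz : z ∈ dualAlgebra θ) : complexify f z ∈ dualAlgebra θ := by
  have hc : ∀ w, complexify θ (complexify f w) = complexify f (complexify θ w) := by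
    intro w
    induction w with
    | zero => simp
    | tmul c x => simp [complexify, hf x]
    | add x y hx hy => simp [hx, hy]
  have hI : ∀ w, complexify f (Complex.I • w) = Complex.I • complexify f w := by
    intro w
    induction w with
    | zero => simp
    | tmul c x => simp [complexify, TensorProduct.smul_tmul']
    | add x y hx hy => simp [hx, hy]
  have ht : ∀ w ∈ toComplexification (⊤ : Submodule ℝ g₀),
      complexify f w ∈ toComplexification (⊤ : Submodule ℝ g₀) := by
    rintro _ ⟨x, -, rfl⟩
    exact ⟨f x, Submodule.mem_top, by simp [complexify]⟩
  obtain ⟨k, hk, p, hp, hk', hp', rfl⟩ := mem_dualSubspace.1 hz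
  exact mem_dualSubspace.2 ⟨_, ht k hk, _, ht p hp, by rw [hc, hk'], by rw [hc, hp', map_neg],
    by rw [map_add, hI]⟩

/-- The restriction to `g` of the `ℂ`-linear extension of `f`, for `f` commuting with `θ`. -/
def dualMap (θ f : g₀ →ₗ⁅ℝ⁆ g₀) (hf : Commuting f θ) : dualAlgebra θ →ₗ⁅ℝ⁆ dualAlgebra θ where
  toFun z := ⟨complexify f z, complexify_mem_dualAlgebra hf z.2⟩
  map_add' x y := Subtype.ext (by simp)
  map_smul' c x := Subtype.ext (by simp)
  map_lie' {x y} := Subtype.ext (by simp)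

/-- The first involution `θ₁ = θ|_g` of the dual triad. -/
def dualTheta₁ (θ : g₀ →ₗ⁅ℝ⁆ g₀) : dualAlgebra θ →ₗ⁅ℝ⁆ dualAlgebra θ :=
  dualMap θ θ (fun _ => rfl)

/-- The second involution `θ₂ = σ|_g` of the dual triad. -/
def dualTheta₂ (σ θ : g₀ →ₗ⁅ℝ⁆ g₀) (h : Commuting σ θ) : dualAlgebra θ →ₗ⁅ℝ⁆ dualAlgebra θ :=
  dualMap θ σ h

/-- For an ideal `l₀` of `g₀`, the ideal `l₀^θ + √-1 l₀^{-θ}` of `g`. -/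
def dualIdeal (θ : g₀ →ₗ⁅ℝ⁆ g₀) (l₀ : LieIdeal ℝ g₀) : LieIdeal ℝ (dualAlgebra θ) where
  toSubmodule := (dualSubspace θ (toComplexification l₀.toSubmodule)).comap
    (dualAlgebra θ).toSubmodule.subtype
  lie_mem {x _} hm := lie_mem_dualSubspace θ (U := ⊤)
    (fun a _ _ hy => lie_mem_right ℝ g₀ l₀ a _ hy) x.2 hm

/-- For an ideal `l` of `g`, the real subspace `l^{θ₁} + √-1 l^{-θ₁}` of the complexification. -/
def dualOfIdeal (θ : g₀ →ₗ⁅ℝ⁆ g₀) (l : LieIdeal ℝ (dualAlgebra θ)) :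
    Submodule ℝ (ℂ ⊗[ℝ] g₀) :=
  dualSubspace θ (l.toSubmodule.map (dualAlgebra θ).toSubmodule.subtype)

end Dual

end SymmDuality

end

/-!
Write `g₀ = k ⊕ p` for the eigenspaces of `θ` with eigenvalues `1` and `-1`. The real linear
isomorphism `φ : x + y ↦ x + √-1 y`, for `x ∈ k` and `y ∈ p`, from `g₀` onto the dual algebra `g`
(`dualEquiv`) intertwines `θ`, `σ` with `θ₁`, `θ₂` (`dualMap_dualEquiv`), and the bracket of `g`
becomes `⁅x + y, z⁆' = ⁅x, z⁆ + ⁅y, θ z⁆` on `g₀` (`lie_dualEquiv`).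

* Taking traces on `g₀` instead of complexifying again, this formula gives
  `B_g(φ (x + y), φ (x + y)) = B(x, x) - B(y, y)` (`killingForm_dualEquiv`), which is negative
  because `-B(·, θ ·)` is positive. A Lie algebra with a definite Killing form is semisimple.
* On `θ`-invariant subspaces, being an ideal for one bracket is the same as being one for the other,
  because the brackets with `x ∈ k` agree and those with `y ∈ p` differ by `θ`. For such an ideal
  `l₀`, the dual `l₀*` is just `φ(l₀)` (`dualEquiv_mem_dualIdeal`), so `l₀ ↦ l₀*` is a bijection
  of invariant ideals (`bijOn_dualIdeal`).
* Irreducibility of `(g₀, σ)` does not mention `θ`, but a Cartan involution preserves every ideal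
  (`IsCartanInvolution.isInvariant`): on an ideal `I` with orthogonal complement `K`, an element
  of `θ I ∩ K` is orthogonal to its image under `θ`, hence zero.
-/

open scoped TensorProduct

noncomputable section

namespace SymmDuality

variable {g₀ : Type*} [LieRing g₀] [LieAlgebra ℝ g₀]

/-! ### Invariance of ideals under a Cartan involution -/

lemma IsCartanInvolution.isKilling {θ : g₀ →ₗ⁅ℝ⁆ g₀} (h : IsCartanInvolution θ) :
    LieAlgebra.IsKilling ℝ g₀ := by
  constructor
  rw [eq_bot_iff]
  intro x hx
  by_contra hx0
  have hpos := h.pos x hx0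
  rw [LieModule.traceForm_comm, (LieIdeal.mem_killingCompl ℝ g₀ ⊤).1 hx _ (LieSubmodule.mem_top _),
    neg_zero] at hpos
  exact hpos.false

/-- A Cartan involution preserves every ideal `I`. Let `K` be the orthogonal complement of `I`. The
involution `θ` maps an element of `θ I ∩ K` into `I`, which is orthogonal to `K`, so by positivity
`θ I ∩ K = 0`. Hence `θ I` is orthogonal to `K`, that is `θ I ≤ I`. -/
lemma IsCartanInvolution.isInvariant [FiniteDimensional ℝ g₀] {θ : g₀ →ₗ⁅ℝ⁆ g₀}
    (h : IsCartanInvolution θ) (I : LieIdeal ℝ g₀) : IsInvariant θ I := by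
  have := h.isKilling
  have hdisj : ∀ x ∈ I, θ x ∈ I.killingCompl → θ x = 0 := by
    intro x hx hθx
    by_contra h0
    have hpos := h.pos _ h0
    rw [h.involution, LieModule.traceForm_comm, (LieIdeal.mem_killingCompl ℝ g₀ I).1 hθx x hx,
      neg_zero] at hpos
    exact hpos.false
  have hrefl : (killingForm ℝ g₀).IsRefl := (LieModule.traceForm_isSymm ℝ g₀ g₀).isRefl
  intro x hx
  have hII := LinearMap.BilinForm.orthogonal_orthogonal
    (LieAlgebra.IsKilling.killingForm_nondegenerate ℝ g₀) hrefl I.toSubmodule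
  rw [← LieSubmodule.mem_toSubmodule, ← hII, ← LieIdeal.toSubmodule_killingCompl]
  rintro y hy
  -- `ad (θ x) ∘ ad y` takes values in `θ I ∩ K`.
  have hcomp : LieAlgebra.ad ℝ g₀ (θ x) ∘ₗ LieAlgebra.ad ℝ g₀ y = 0 := by
    ext z
    have hyz : ⁅y, z⁆ ∈ I.killingCompl := lie_mem_left ℝ g₀ _ _ _ hy
    have hθ : θ ⁅x, θ ⁅y, z⁆⁆ = ⁅θ x, ⁅y, z⁆⁆ := by rw [LieHom.map_lie, h.involution]
    simp only [LinearMap.comp_apply, LieAlgebra.ad_apply, LinearMap.zero_apply]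
    rw [← hθ]
    refine hdisj _ (lie_mem_left ℝ g₀ _ _ _ hx) ?_
    rw [hθ]
    exact lie_mem_right ℝ g₀ _ _ _ hyz
  change killingForm ℝ g₀ y (θ x) = 0
  rw [LieModule.traceForm_comm, killingForm_apply_apply, hcomp, map_zero]

/-! ### Coordinates on the dual subspaces -/

variable (g₀) in
/-- The sum of the real and the imaginary part, `a + √-1 b ↦ a + b`. On the dual algebra it inverts
the duality isomorphism. -/
def reAddIm : ℂ ⊗[ℝ] g₀ →ₗ[ℝ] g₀ :=
  (TensorProduct.lid ℝ g₀).toLinearMap ∘ₗ (Complex.reLm + Complex.imLm).rTensor g₀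

@[simp]
lemma reAddIm_tmul (c : ℂ) (x : g₀) : reAddIm g₀ (c ⊗ₜ x) = (c.re + c.im) • x := by
  simp [reAddIm, add_smul]

@[simp]
lemma complexify_tmul (f : g₀ →ₗ⁅ℝ⁆ g₀) (c : ℂ) (x : g₀) :
    complexify f (c ⊗ₜ x) = c ⊗ₜ f x := by
  simp [complexify]

lemma mem_dualSubspace_toComplexification {θ : g₀ →ₗ⁅ℝ⁆ g₀} {W : Submodule ℝ g₀}
    {z : ℂ ⊗[ℝ] g₀} :
    z ∈ dualSubspace θ (toComplexification W) ↔ ∃ k ∈ W, ∃ p ∈ W, θ k = k ∧ θ p = -p ∧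
      z = 1 ⊗ₜ k + Complex.I ⊗ₜ p := by
  rw [mem_dualSubspace]
  constructor
  · rintro ⟨_, ⟨k, hk, rfl⟩, _, ⟨p, hp, rfl⟩, hk', hp', rfl⟩
    refine ⟨k, hk, p, hp, ?_, ?_, by simp [TensorProduct.smul_tmul']⟩
    · simpa using congrArg (reAddIm g₀) hk'
    · simpa using congrArg (reAddIm g₀) hp'
  · rintro ⟨k, hk, p, hp, hk', hp', rfl⟩
    exact ⟨_, ⟨k, hk, rfl⟩, _, ⟨p, hp, rfl⟩, by simp [hk'], by simp [hp', TensorProduct.tmul_neg],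
      by simp [TensorProduct.smul_tmul']⟩

/-- The projection `(1 + θ) / 2` onto the fixed points of an involution `θ`. -/
def fixedPart (θ : g₀ →ₗ⁅ℝ⁆ g₀) : g₀ →ₗ[ℝ] g₀ := (2⁻¹ : ℝ) • (LinearMap.id + (θ : g₀ →ₗ[ℝ] g₀))

/-- The projection `(1 - θ) / 2` onto the `-1`-eigenspace of an involution `θ`. -/
def antifixedPart (θ : g₀ →ₗ⁅ℝ⁆ g₀) : g₀ →ₗ[ℝ] g₀ :=
  (2⁻¹ : ℝ) • (LinearMap.id - (θ : g₀ →ₗ[ℝ] g₀))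

lemma fixedPart_apply (θ : g₀ →ₗ⁅ℝ⁆ g₀) (x : g₀) : fixedPart θ x = (2⁻¹ : ℝ) • (x + θ x) := rfl

lemma antifixedPart_apply (θ : g₀ →ₗ⁅ℝ⁆ g₀) (x : g₀) :
    antifixedPart θ x = (2⁻¹ : ℝ) • (x - θ x) := rfl

variable {θ : g₀ →ₗ⁅ℝ⁆ g₀}

lemma fixedPart_add_antifixedPart (x : g₀) : fixedPart θ x + antifixedPart θ x = x := by
  rw [fixedPart_apply, antifixedPart_apply]; module

lemma fixedPart_sub_antifixedPart (x : g₀) : fixedPart θ x - antifixedPart θ x = θ x := by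
  rw [fixedPart_apply, antifixedPart_apply]; module

lemma map_fixedPart (hθ : IsInvolution θ) (x : g₀) : θ (fixedPart θ x) = fixedPart θ x := by
  rw [fixedPart_apply, map_smul, map_add, hθ, add_comm]

lemma map_antifixedPart (hθ : IsInvolution θ) (x : g₀) :
    θ (antifixedPart θ x) = -antifixedPart θ x := by
  rw [antifixedPart_apply, map_smul, map_sub, hθ, ← smul_neg, neg_sub]

lemma fixedPart_add {k p : g₀} (hk : θ k = k) (hp : θ p = -p) : fixedPart θ (k + p) = k := by
  rw [fixedPart_apply, map_add, hk, hp]; module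

lemma antifixedPart_add {k p : g₀} (hk : θ k = k) (hp : θ p = -p) :
    antifixedPart θ (k + p) = p := by
  rw [antifixedPart_apply, map_add, hk, hp]; module

lemma fixedPart_map {f : g₀ →ₗ⁅ℝ⁆ g₀} (hf : Commuting f θ) (x : g₀) :
    fixedPart θ (f x) = f (fixedPart θ x) := by
  simp [fixedPart_apply, hf x]

lemma antifixedPart_map {f : g₀ →ₗ⁅ℝ⁆ g₀} (hf : Commuting f θ) (x : g₀) :
    antifixedPart θ (f x) = f (antifixedPart θ x) := by
  simp [antifixedPart_apply, hf x]

lemma IsInvariant.fixedPart_mem {I : LieIdeal ℝ g₀} (hI : IsInvariant θ I) {x : g₀} (hx : x ∈ I) :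
    fixedPart θ x ∈ I :=
  I.smul_mem _ (add_mem hx (hI x hx))

lemma IsInvariant.antifixedPart_mem {I : LieIdeal ℝ g₀} (hI : IsInvariant θ I) {x : g₀}
    (hx : x ∈ I) : antifixedPart θ x ∈ I :=
  I.smul_mem _ (sub_mem hx (hI x hx))

/-! ### The duality isomorphism of vector spaces -/

/-- The real linear isomorphism `k + p ↦ k + √-1 p` from `g₀` onto its dual, where `k` and `p` lie
in the `1`- and the `-1`-eigenspace of the involution `θ`. It does not respect the brackets. -/
def dualEquiv (hθ : IsInvolution θ) : g₀ ≃ₗ[ℝ] dualAlgebra θ where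
  toFun x := ⟨1 ⊗ₜ fixedPart θ x + Complex.I ⊗ₜ antifixedPart θ x,
    mem_dualSubspace_toComplexification.2 ⟨_, Submodule.mem_top, _, Submodule.mem_top,
      map_fixedPart hθ x, map_antifixedPart hθ x, rfl⟩⟩
  map_add' x y := Subtype.ext (by simp [TensorProduct.tmul_add]; abel)
  map_smul' c x := Subtype.ext (by simp)
  invFun z := reAddIm g₀ z
  left_inv x := by simp [fixedPart_add_antifixedPart]
  right_inv := by
    rintro ⟨z, hz⟩
    obtain ⟨k, -, p, -, hk, hp, rfl⟩ := mem_dualSubspace_toComplexification.1 hz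
    have hz' : reAddIm g₀ (1 ⊗ₜ k + Complex.I ⊗ₜ p) = k + p := by simp
    refine Subtype.ext ?_
    simp only [hz', fixedPart_add hk hp, antifixedPart_add hk hp]

variable (hθ : IsInvolution θ)

lemma coe_dualEquiv (x : g₀) : (dualEquiv hθ x : ℂ ⊗[ℝ] g₀) =
    1 ⊗ₜ fixedPart θ x + Complex.I ⊗ₜ antifixedPart θ x := rfl

lemma coe_dualEquiv_add {k p : g₀} (hk : θ k = k) (hp : θ p = -p) :
    (dualEquiv hθ (k + p) : ℂ ⊗[ℝ] g₀) = 1 ⊗ₜ k + Complex.I ⊗ₜ p := by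
  rw [coe_dualEquiv, fixedPart_add hk hp, antifixedPart_add hk hp]

lemma dualMap_dualEquiv {f : g₀ →ₗ⁅ℝ⁆ g₀} (hf : Commuting f θ) (x : g₀) :
    dualMap θ f hf (dualEquiv hθ x) = dualEquiv hθ (f x) := by
  refine Subtype.ext ?_
  change complexify f (dualEquiv hθ x : ℂ ⊗[ℝ] g₀) = _
  simp [coe_dualEquiv, fixedPart_map hf, antifixedPart_map hf]

/-- The bracket of the dual algebra, read on `g₀`: `⁅k + p, y⁆` becomes `⁅k, y⁆ + ⁅p, θ y⁆`, since
moving `√-1` past `√-1` gives a sign exactly on the `-1`-eigenspace. -/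
lemma lie_dualEquiv (x y : g₀) : ⁅dualEquiv hθ x, dualEquiv hθ y⁆ =
    dualEquiv hθ (⁅fixedPart θ x, y⁆ + ⁅antifixedPart θ x, θ y⁆) := by
  have hk := map_fixedPart hθ x
  have hp := map_antifixedPart hθ x
  have hl := map_fixedPart hθ y
  have hq := map_antifixedPart hθ y
  have hy := fixedPart_add_antifixedPart (θ := θ) y
  have hθy := fixedPart_sub_antifixedPart (θ := θ) y
  have hx : ((dualEquiv hθ x : dualAlgebra θ) : ℂ ⊗[ℝ] g₀) = _ := coe_dualEquiv hθ x
  have hy' : ((dualEquiv hθ y : dualAlgebra θ) : ℂ ⊗[ℝ] g₀) = _ := coe_dualEquiv hθ y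
  generalize fixedPart θ x = k at *
  generalize antifixedPart θ x = p at *
  generalize fixedPart θ y = l at *
  generalize antifixedPart θ y = q at *
  have hsplit : ⁅k, y⁆ + ⁅p, θ y⁆ = (⁅k, l⁆ - ⁅p, q⁆) + (⁅k, q⁆ + ⁅p, l⁆) := by
    rw [← hθy, ← hy, lie_add, lie_sub]; abel
  refine Subtype.ext ?_
  rw [hsplit, coe_dualEquiv_add hθ (by simp [hk, hp, hl, hq]) (by simp [hk, hp, hl, hq]; abel),
    LieSubalgebra.coe_bracket, hx, hy']
  simp [TensorProduct.tmul_sub, TensorProduct.tmul_add, TensorProduct.neg_tmul]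
  abel

/-! ### The Killing form of the dual algebra -/

lemma trace_comp_eq_zero_of_anticomm {V : Type*} [AddCommGroup V] [Module ℝ V]
    (S T : V →ₗ[ℝ] V) (h : T ∘ₗ S = -(S ∘ₗ T)) : LinearMap.trace ℝ V (S ∘ₗ T) = 0 := by
  have h1 : LinearMap.trace ℝ V (T ∘ₗ S) = _ := LinearMap.trace_mul_comm ℝ T S
  rw [h, map_neg, ← Module.End.mul_eq_comp] at h1
  rw [← Module.End.mul_eq_comp]
  linarith

/-- The Killing form of the dual algebra at `k + √-1 p` is `B(k, k) - B(p, p)`. On `g₀` the adjoint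
action of `k + √-1 p` reads `T = ad k + ad p ∘ θ`, and
`T² = (ad k)² - (ad p)² + (ad k ∘ ad p + ad p ∘ ad k) ∘ θ`. The last summand is traceless,
since `θ` commutes with `ad k` and anticommutes with `ad p`. -/
lemma killingForm_dualEquiv [FiniteDimensional ℝ g₀] (x : g₀) :
    killingForm ℝ (dualAlgebra θ) (dualEquiv hθ x) (dualEquiv hθ x) =
      killingForm ℝ g₀ (fixedPart θ x) (fixedPart θ x) -
        killingForm ℝ g₀ (antifixedPart θ x) (antifixedPart θ x) := by
  have hk := map_fixedPart hθ x
  have hp := map_antifixedPart hθ x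
  have hlie := lie_dualEquiv hθ x
  generalize fixedPart θ x = k at *
  generalize antifixedPart θ x = p at *
  have had : LieAlgebra.ad ℝ (dualAlgebra θ) (dualEquiv hθ x) = (dualEquiv hθ).conj
      (LieAlgebra.ad ℝ g₀ k + LieAlgebra.ad ℝ g₀ p ∘ₗ (θ : g₀ →ₗ[ℝ] g₀)) := by
    ext1 z
    obtain ⟨y, rfl⟩ := (dualEquiv hθ).surjective z
    simp only [LieAlgebra.ad_apply, hlie, LinearEquiv.conj_apply_apply,
      LinearEquiv.symm_apply_apply, LinearMap.add_apply, LinearMap.comp_apply,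
      LieHom.coe_toLinearMap]
  have hsq : (LieAlgebra.ad ℝ g₀ k + LieAlgebra.ad ℝ g₀ p ∘ₗ (θ : g₀ →ₗ[ℝ] g₀)) ∘ₗ
      (LieAlgebra.ad ℝ g₀ k + LieAlgebra.ad ℝ g₀ p ∘ₗ (θ : g₀ →ₗ[ℝ] g₀)) =
      LieAlgebra.ad ℝ g₀ k ∘ₗ LieAlgebra.ad ℝ g₀ k -
        LieAlgebra.ad ℝ g₀ p ∘ₗ LieAlgebra.ad ℝ g₀ p +
      (LieAlgebra.ad ℝ g₀ k ∘ₗ LieAlgebra.ad ℝ g₀ p +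
        LieAlgebra.ad ℝ g₀ p ∘ₗ LieAlgebra.ad ℝ g₀ k) ∘ₗ (θ : g₀ →ₗ[ℝ] g₀) := by
    ext y
    simp [hk, hp, hθ y, -lie_skew]
    abel
  have hcross : LinearMap.trace ℝ g₀ ((LieAlgebra.ad ℝ g₀ k ∘ₗ LieAlgebra.ad ℝ g₀ p +
      LieAlgebra.ad ℝ g₀ p ∘ₗ LieAlgebra.ad ℝ g₀ k) ∘ₗ (θ : g₀ →ₗ[ℝ] g₀)) = 0 := by
    refine trace_comp_eq_zero_of_anticomm _ _ ?_
    ext y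
    simp [hk, hp, -lie_skew, -lie_lie]
    abel
  rw [killingForm_apply_apply, had, ← LinearEquiv.conj_comp, LinearMap.trace_conj', hsq, map_add,
    map_sub, hcross, add_zero, killingForm_apply_apply, killingForm_apply_apply]

lemma IsCartanInvolution.isCompactSemisimple_dualAlgebra [FiniteDimensional ℝ g₀]
    (h : IsCartanInvolution θ) : IsCompactSemisimple (dualAlgebra θ) := by
  have : Module.Finite ℝ (dualAlgebra θ) := Module.Finite.equiv (dualEquiv h.involution)
  have hneg : ∀ z : dualAlgebra θ, z ≠ 0 → killingForm ℝ (dualAlgebra θ) z z < 0 := by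
    intro z hz
    obtain ⟨x, rfl⟩ := (dualEquiv h.involution).surjective z
    rw [killingForm_dualEquiv]
    have hk : ∀ y, θ y = y → killingForm ℝ g₀ y y ≤ 0 ∧ (killingForm ℝ g₀ y y = 0 → y = 0) := by
      intro y hy
      by_cases hy0 : y = 0
      · simp [hy0]
      · have := h.pos y hy0
        rw [hy] at this
        exact ⟨by linarith, fun h0 => by linarith⟩
    have hp : ∀ y, θ y = -y → 0 ≤ killingForm ℝ g₀ y y ∧ (killingForm ℝ g₀ y y = 0 → y = 0) := by
      intro y hy
      by_cases hy0 : y = 0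
      · simp [hy0]
      · have := h.pos y hy0
        rw [hy, map_neg, neg_neg] at this
        exact ⟨by linarith, fun h0 => by linarith⟩
    obtain ⟨hk1, hk2⟩ := hk _ (map_fixedPart h.involution x)
    obtain ⟨hp1, hp2⟩ := hp _ (map_antifixedPart h.involution x)
    refine lt_of_le_of_ne (by linarith) fun h0 => hz ?_
    have hx := fixedPart_add_antifixedPart (θ := θ) x
    rw [hk2 (by linarith), hp2 (by linarith), add_zero] at hx
    rw [← hx, map_zero]
  have : LieAlgebra.IsKilling ℝ (dualAlgebra θ) := by
    constructor
    rw [eq_bot_iff]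
    intro z hz
    by_contra hz0
    exact (hneg z hz0).ne ((LieIdeal.mem_killingCompl ℝ _ ⊤).1 hz z (LieSubmodule.mem_top _))
  exact ⟨inferInstance, hneg⟩

/-! ### Duality of invariant ideals -/

lemma isInvolution_dualMap (hθ : IsInvolution θ) {f : g₀ →ₗ⁅ℝ⁆ g₀} (hf : Commuting f θ)
    (hf2 : IsInvolution f) :
    IsInvolution (dualMap θ f hf) := by
  intro z
  obtain ⟨x, rfl⟩ := (dualEquiv hθ).surjective z
  rw [dualMap_dualEquiv, dualMap_dualEquiv, hf2]

lemma commuting_dualMap (hθ : IsInvolution θ) {f f' : g₀ →ₗ⁅ℝ⁆ g₀} (hf : Commuting f θ)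
    (hf' : Commuting f' θ) (hff' : Commuting f f') : Commuting (dualMap θ f hf) (dualMap θ f' hf') := by
  intro z
  obtain ⟨x, rfl⟩ := (dualEquiv hθ).surjective z
  simp only [dualMap_dualEquiv, hff' x]

lemma dualEquiv_mem_dualIdeal {l₀ : LieIdeal ℝ g₀} (hl : IsInvariant θ l₀) {x : g₀} :
    dualEquiv hθ x ∈ dualIdeal θ l₀ ↔ x ∈ l₀ := by
  change ((dualEquiv hθ x : dualAlgebra θ) : ℂ ⊗[ℝ] g₀) ∈
    dualSubspace θ (toComplexification l₀.toSubmodule) ↔ _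
  rw [mem_dualSubspace_toComplexification]
  constructor
  · rintro ⟨k, hk, p, hp, hk', hp', hz⟩
    rw [← coe_dualEquiv_add hθ hk' hp', Subtype.coe_inj, EmbeddingLike.apply_eq_iff_eq] at hz
    rw [hz]
    exact add_mem hk hp
  · intro hx
    exact ⟨_, hl.fixedPart_mem hx, _, hl.antifixedPart_mem hx, map_fixedPart hθ x,
      map_antifixedPart hθ x, rfl⟩

lemma isInvariant_dualMap_dualIdeal (hθ : IsInvolution θ) {f : g₀ →ₗ⁅ℝ⁆ g₀}
    (hf : Commuting f θ) {l₀ : LieIdeal ℝ g₀} (hl : IsInvariant θ l₀) (hfl : IsInvariant f l₀) :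
    IsInvariant (dualMap θ f hf) (dualIdeal θ l₀) := by
  intro z hz
  obtain ⟨x, rfl⟩ := (dualEquiv hθ).surjective z
  rw [dualMap_dualEquiv, dualEquiv_mem_dualIdeal hθ hl]
  exact hfl x ((dualEquiv_mem_dualIdeal hθ hl).1 hz)

/-- The preimage in `g₀`, under the duality isomorphism `φ`, of an ideal `l` of the dual algebra
invariant under `θ₁`. It is an ideal: `φ ⁅k, y⁆ = ⁅φ k, φ y⁆` for `θ k = k`, while
`φ ⁅p, y⁆ = ⁅φ p, φ (θ y)⁆` for `θ p = -p`, and `φ (θ y) = θ₁ (φ y)` lies in `l` with `φ y`. -/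
def preimageIdeal (l : LieIdeal ℝ (dualAlgebra θ)) (hl : IsInvariant (dualTheta₁ θ) l) :
    LieIdeal ℝ g₀ where
  toSubmodule := l.toSubmodule.comap (dualEquiv hθ).toLinearMap
  lie_mem {a y} hy := by
    have hy1 : dualEquiv hθ y ∈ l := hy
    have hy2 : dualEquiv hθ (θ y) ∈ l := dualMap_dualEquiv hθ (fun _ => rfl) y ▸ hl _ hy1
    have hk := map_fixedPart hθ a
    have hp := map_antifixedPart hθ a
    rw [← fixedPart_add_antifixedPart (θ := θ) a, add_lie]
    generalize fixedPart θ a = k at *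
    generalize antifixedPart θ a = p at *
    have h1 := lie_dualEquiv hθ k y
    have h2 := lie_dualEquiv hθ p (θ y)
    rw [show fixedPart θ k = k by simpa using fixedPart_add hk (p := 0) (by simp),
      show antifixedPart θ k = 0 by simpa using antifixedPart_add hk (p := 0) (by simp),
      zero_lie, add_zero] at h1
    rw [show fixedPart θ p = 0 by simpa using fixedPart_add (k := 0) (by simp) hp,
      show antifixedPart θ p = p by simpa using antifixedPart_add (k := 0) (by simp) hp,
      zero_lie, zero_add, hθ] at h2
    change dualEquiv hθ (⁅k, y⁆ + ⁅p, y⁆) ∈ l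
    rw [map_add, ← h1, ← h2]
    exact add_mem (lie_mem_right ℝ _ _ _ _ hy1) (lie_mem_right ℝ _ _ _ _ hy2)

lemma mem_preimageIdeal {l : LieIdeal ℝ (dualAlgebra θ)} (hl : IsInvariant (dualTheta₁ θ) l)
    {x : g₀} : x ∈ preimageIdeal hθ l hl ↔ dualEquiv hθ x ∈ l := Iff.rfl

lemma isInvariant_preimageIdeal {l : LieIdeal ℝ (dualAlgebra θ)}
    (hl : IsInvariant (dualTheta₁ θ) l) {f : g₀ →ₗ⁅ℝ⁆ g₀} (hf : Commuting f θ)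
    (hfl : IsInvariant (dualMap θ f hf) l) : IsInvariant f (preimageIdeal hθ l hl) := by
  intro x hx
  rw [mem_preimageIdeal, ← dualMap_dualEquiv hθ hf]
  exact hfl _ hx

lemma dualIdeal_preimageIdeal {l : LieIdeal ℝ (dualAlgebra θ)}
    (hl : IsInvariant (dualTheta₁ θ) l) : dualIdeal θ (preimageIdeal hθ l hl) = l := by
  ext z
  obtain ⟨x, rfl⟩ := (dualEquiv hθ).surjective z
  rw [dualEquiv_mem_dualIdeal hθ (isInvariant_preimageIdeal hθ hl (fun _ => rfl) hl),
    mem_preimageIdeal]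

lemma dualIdeal_bot (hθ : IsInvolution θ) : dualIdeal θ ⊥ = ⊥ := by
  ext z
  obtain ⟨x, rfl⟩ := (dualEquiv hθ).surjective z
  rw [dualEquiv_mem_dualIdeal hθ (by rintro x rfl; simp)]
  simp

lemma dualIdeal_top (hθ : IsInvolution θ) : dualIdeal θ ⊤ = ⊤ := by
  ext z
  obtain ⟨x, rfl⟩ := (dualEquiv hθ).surjective z
  rw [dualEquiv_mem_dualIdeal hθ (fun _ _ => LieSubmodule.mem_top _)]
  simp

lemma dualIdeal_injOn (hθ : IsInvolution θ) :
    Set.InjOn (dualIdeal θ) {l₀ : LieIdeal ℝ g₀ | IsInvariant θ l₀} := by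
  intro I hI J hJ hIJ
  ext x
  rw [← dualEquiv_mem_dualIdeal hθ hI, hIJ, dualEquiv_mem_dualIdeal hθ hJ]

lemma bijOn_dualIdeal (hθ : IsInvolution θ) {σ : g₀ →ₗ⁅ℝ⁆ g₀} (hσ : Commuting σ θ) :
    Set.BijOn (dualIdeal θ) (invariantIdeals σ θ)
      (invariantIdeals (dualTheta₁ θ) (dualTheta₂ σ θ hσ)) := by
  refine ⟨fun l₀ h => ⟨?_, ?_⟩, (dualIdeal_injOn hθ).mono fun l₀ h => h.2, fun l h => ?_⟩
  · exact isInvariant_dualMap_dualIdeal hθ _ h.2 h.2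
  · exact isInvariant_dualMap_dualIdeal hθ hσ h.2 h.1
  · exact ⟨preimageIdeal hθ l h.1, ⟨isInvariant_preimageIdeal hθ h.1 hσ h.2,
      isInvariant_preimageIdeal hθ h.1 (fun _ => rfl) h.1⟩, dualIdeal_preimageIdeal hθ h.1⟩

/-- Dualizing an ideal twice gives back the ideal, because `√-1 (√-1 p) = -p`
and the sign does not matter for a subspace. -/
lemma dualOfIdeal_dualIdeal (hθ : IsInvolution θ) {l₀ : LieIdeal ℝ g₀} (hl : IsInvariant θ l₀) :
    dualOfIdeal θ (dualIdeal θ l₀) = toComplexification l₀.toSubmodule := by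
  have hmem : ∀ w : ℂ ⊗[ℝ] g₀,
      w ∈ (dualIdeal θ l₀).toSubmodule.map (dualAlgebra θ).toSubmodule.subtype ↔
        ∃ x ∈ l₀, (dualEquiv hθ x : ℂ ⊗[ℝ] g₀) = w := by
    intro w
    constructor
    · rintro ⟨z, hz, rfl⟩
      obtain ⟨x, rfl⟩ := (dualEquiv hθ).surjective z
      exact ⟨x, (dualEquiv_mem_dualIdeal hθ hl).1 hz, rfl⟩
    · rintro ⟨x, hx, rfl⟩
      exact ⟨dualEquiv hθ x, (dualEquiv_mem_dualIdeal hθ hl).2 hx, rfl⟩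
  have hθ₁ : ∀ x, complexify θ (dualEquiv hθ x : ℂ ⊗[ℝ] g₀) = (dualEquiv hθ (θ x) : ℂ ⊗[ℝ] g₀) :=
    fun x => congrArg Subtype.val (dualMap_dualEquiv hθ (fun _ => rfl) x)
  ext w
  rw [dualOfIdeal, mem_dualSubspace]
  constructor
  · rintro ⟨a, ha, b, hb, ha', hb', rfl⟩
    obtain ⟨k, hk, rfl⟩ := (hmem a).1 ha
    obtain ⟨p, hp, rfl⟩ := (hmem b).1 hb
    rw [hθ₁, Subtype.coe_inj, EmbeddingLike.apply_eq_iff_eq] at ha'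
    rw [hθ₁, ← NegMemClass.coe_neg, Subtype.coe_inj, ← map_neg,
      EmbeddingLike.apply_eq_iff_eq] at hb'
    refine ⟨k - p, sub_mem hk hp, ?_⟩
    rw [← add_zero k, coe_dualEquiv_add hθ ha' (by simp), ← zero_add p,
      coe_dualEquiv_add hθ (by simp) hb']
    simp [TensorProduct.smul_tmul', TensorProduct.neg_tmul, sub_eq_add_neg,
      TensorProduct.tmul_add, TensorProduct.tmul_neg]
  · rintro ⟨x, hx, rfl⟩
    have hk := map_fixedPart hθ x
    have hp := map_antifixedPart hθ x
    -- The component `-p` makes up for the sign of `√-1 (√-1 (-p)) = p`.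
    refine ⟨_, (hmem _).2 ⟨_, hl.fixedPart_mem hx, rfl⟩, _,
      (hmem _).2 ⟨_, neg_mem (hl.antifixedPart_mem hx), rfl⟩, ?_, ?_, ?_⟩
    · rw [hθ₁, hk]
    · rw [hθ₁, map_neg, hp]; simp
    · have hx' := fixedPart_add_antifixedPart (θ := θ) x
      generalize fixedPart θ x = k at *
      generalize antifixedPart θ x = p at *
      have h1 := coe_dualEquiv_add hθ hk (p := 0) (by simp)
      have h2 := coe_dualEquiv_add hθ (k := 0) (p := -p) (by simp) (by simp [hp])
      rw [add_zero] at h1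
      rw [zero_add] at h2
      rw [h1, h2, ← hx']
      simp [TensorProduct.smul_tmul', TensorProduct.tmul_neg, TensorProduct.neg_tmul,
        TensorProduct.tmul_add]

/-- Irreducibility corresponds under duality: a Cartan involution preserves every ideal, so on the
side of `g₀` the invariance under `θ` need not be required. -/
lemma isIrreduciblePair_iff [FiniteDimensional ℝ g₀] {σ : g₀ →ₗ⁅ℝ⁆ g₀}
    (h : IsCartanInvolution θ) (hσ : Commuting σ θ) :
    IsIrreduciblePair σ ↔ IsIrreducibleTriad (dualTheta₁ θ) (dualTheta₂ σ θ hσ) := by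
  have hθ := h.involution
  constructor
  · intro hirr l hl₁ hl₂
    obtain ⟨l₀, hl₀, rfl⟩ := (bijOn_dualIdeal hθ hσ).surjOn ⟨hl₁, hl₂⟩
    rcases hirr l₀ hl₀.1 with rfl | rfl
    · exact .inl (dualIdeal_bot hθ)
    · exact .inr (dualIdeal_top hθ)
  · intro hirr l₀ hl₀
    obtain ⟨h₁, h₂⟩ := (bijOn_dualIdeal hθ hσ).mapsTo ⟨hl₀, h.isInvariant l₀⟩
    rcases hirr _ h₁ h₂ with h0 | h0
    · exact .inl (dualIdeal_injOn hθ (h.isInvariant _) (h.isInvariant _)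
        (h0.trans (dualIdeal_bot hθ).symm))
    · exact .inr (dualIdeal_injOn hθ (h.isInvariant _) (h.isInvariant _)
        (h0.trans (dualIdeal_top hθ).symm))

end SymmDuality

end

theorem mainTheorem5 {g₀ : Type*} [LieRing g₀] [LieAlgebra ℝ g₀] [FiniteDimensional ℝ g₀]
    (σ θ : g₀ →ₗ⁅ℝ⁆ g₀) (h : SymmDuality.IsNoncompactPairWithCartan σ θ) :
    SymmDuality.IsCommCompactTriad (SymmDuality.dualTheta₁ θ) (SymmDuality.dualTheta₂ σ θ h.comm) ∧
    Set.BijOn (SymmDuality.dualIdeal θ)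
      (SymmDuality.invariantIdeals σ θ)
      (SymmDuality.invariantIdeals (SymmDuality.dualTheta₁ θ)
        (SymmDuality.dualTheta₂ σ θ h.comm)) ∧
    (∀ l₀ ∈ SymmDuality.invariantIdeals σ θ,
      SymmDuality.dualOfIdeal θ (SymmDuality.dualIdeal θ l₀) =
        SymmDuality.toComplexification l₀.toSubmodule) ∧
    (SymmDuality.IsIrreduciblePair σ ↔
      SymmDuality.IsIrreducibleTriad (SymmDuality.dualTheta₁ θ)
        (SymmDuality.dualTheta₂ σ θ h.comm)) := by
  obtain ⟨hpair, hcartan, hcomm⟩ := h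
  have hθ := hcartan.involution
  exact ⟨⟨hcartan.isCompactSemisimple_dualAlgebra, SymmDuality.isInvolution_dualMap hθ _ hθ,
      SymmDuality.isInvolution_dualMap hθ hcomm hpair.involution,
      SymmDuality.commuting_dualMap hθ _ hcomm fun x => (hcomm x).symm⟩,
    SymmDuality.bijOn_dualIdeal hθ hcomm,
    fun _ hl₀ => SymmDuality.dualOfIdeal_dualIdeal hθ hl₀.2,
    SymmDuality.isIrreduciblePair_iff hcartan hcomm⟩
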